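/- A simplicial complex $H=(V,E)$ consists of a finite vertex set $V$ and a family $E$ of subsets of $V$ (edges, of any size, the empty set included) closed under taking subsets. A complex $H$ contains a copy of a complex $F$ if there is an injection $V(F)\to V(H)$ that maps every edge of $F$ to an edge of $H$; and $\mathrm{ex}(n,F)$ denotes the maximum number of edges of a simplicial complex on $n$ vertices that contains no copy of $F$. Let $B$ be the simplicial complex on the five vertices $v_1,\dots,v_5$ whose edges are all subsets of $\{v_3,v_4\}$, $\{v_1,v_2,v_3\}$ and $\{v_1,v_4,v_5\}$. Then there is a constant $C\in\mathbb N$ such that $$\mathrm{ex}(n,B)\le \frac98\binom n2+\frac{21}{16}\,n+C\qquad\text{for every } n\ge 5 .$$ This bound is best possible up to the additive constant: there is a constant $C'\in\mathbb N$ with $\mathrm{ex}(n,B)\ge \frac98\binom n2+\frac{21}{16}n-C'$ for every $n\ge5$, and, more precisely, $\mathrm{ex}(n,B)\ge \frac98\binom n2+\frac{21}{16}n+\frac54$ whenever $n\equiv 6 \pmod 8$. -/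

import Mathlib

/-- A simplicial complex with vertex set `V` and a finite edge set closed under taking subsets.
The empty set counts as an edge, and a vertex need not be an edge by itself. (Mathlib's
`AbstractSimplicialComplex` excludes the empty face and forces every singleton to be a face.) -/
structure FinComplex (V : Type*) where
  edges : Finset (Finset V)
  down_closed : ∀ e ∈ edges, ∀ e' ⊆ e, e' ∈ edges

namespace FinComplex

/-- The simplicial complex whose edges are all subsets of members of `G`. -/
def generate {V : Type*} [DecidableEq V] (G : Finset (Finset V)) : FinComplex V where
  edges := G.biUnion Finset.powerset
  down_closed := by
    intro e he e' h
    simp only [Finset.mem_biUnion, Finset.mem_powerset] at he ⊢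
    obtain ⟨g, hg, hs⟩ := he
    exact ⟨g, hg, h.trans hs⟩

/-- `H` contains a (not necessarily induced) copy of `F`: an injection of the vertices of `F` into
those of `H` that maps edges to edges. -/
def Contains {V W : Type*} (H : FinComplex V) (F : FinComplex W) : Prop :=
  ∃ f : W ↪ V, ∀ e ∈ F.edges, e.map f ∈ H.edges

/-- The extremal number: the maximum number of edges (of all sizes) of a simplicial complex on `n`
vertices that contains no copy of `F`. -/
noncomputable def ex {W : Type*} (n : ℕ) (F : FinComplex W) : ℕ :=
  sSup {m : ℕ | ∃ H : FinComplex (Fin n), ¬ H.Contains F ∧ H.edges.card = m}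

/-- The supremum defining `ex n F` is an attained maximum as soon as `F` has an edge. -/
theorem ex_isGreatest {W : Type*} (n : ℕ) (F : FinComplex W) (hF : F.edges.Nonempty) :
    IsGreatest {m : ℕ | ∃ H : FinComplex (Fin n), ¬ H.Contains F ∧ H.edges.card = m}
      (ex n F) := by
  have hb : BddAbove {m : ℕ | ∃ H : FinComplex (Fin n), ¬ H.Contains F ∧ H.edges.card = m} := by
    refine ⟨Fintype.card (Finset (Fin n)), ?_⟩
    rintro m ⟨H, -, rfl⟩
    exact Finset.card_le_univ _
  have hne : {m : ℕ | ∃ H : FinComplex (Fin n), ¬ H.Contains F ∧ H.edges.card = m}.Nonempty := by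
    obtain ⟨e, he⟩ := hF
    refine ⟨0, ⟨∅, by simp⟩, ?_, by simp⟩
    rintro ⟨f, hf⟩
    simpa using hf e he
  exact ⟨Nat.sSup_mem hne hb, fun m hm => le_csSup hb hm⟩

/-- The complex `B` on the vertices `v₁, …, v₅ = 0, …, 4` generated by
`v₃v₄`, `v₁v₂v₃` and `v₁v₄v₅`. -/
def bowtie : FinComplex (Fin 5) :=
  generate {{2, 3}, {0, 1, 2}, {0, 3, 4}}

end FinComplex

/-!
Call the edges meeting a triangle `D` its cost. As long as some triangle of a bowtie-free complex
on `n ≥ 13` vertices costs at most `(54 n - 45) / 16`, delete it and induct. If every triangle costs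
more, then every triangle contains exactly one *spine*, a pair extended to an edge by at least three
vertices (its *pages*) and in fact by more than `(6 n + 3) / 16`. A spine is disjoint from every
other spine and from the pages of all spines. Two spines with a common page are joined by no pair,
and two spines without one miss more page incidences than the pairs between them make up for. So in
terms of the number `m` of spines and the number `a = n - 2 m` of remaining vertices, the number of
edges is at most that of the complex in which all `a` vertices are pages of all `m` spines. This is
`(9 n ^ 2 + 12 n + 20 - (a + 2 - 6 m) ^ 2) / 16`, and choosing `m` with `8 m` close to `n + 2` gives
the lower bound.
-/

open Finset

section CountingLemmas

variable {α : Type*} [DecidableEq α]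

theorem card_le_of_one_le_sum_inv_degree {F : Finset (Finset α)} {R : Finset α}
    (hR : ∀ s ∈ F, s ⊆ R) (hF : ∀ s ∈ F, (1 : ℚ) ≤ ∑ y ∈ s, (#{t ∈ F | y ∈ t} : ℚ)⁻¹) :
    #F ≤ #R := by
  have hcount : (#F : ℚ) ≤ #R := calc
    (#F : ℚ) = ∑ s ∈ F, 1 := by simp
    _ ≤ ∑ s ∈ F, ∑ y ∈ s, (#{t ∈ F | y ∈ t} : ℚ)⁻¹ := sum_le_sum hF
    _ = ∑ y ∈ R, ∑ s ∈ F with y ∈ s, (#{t ∈ F | y ∈ t} : ℚ)⁻¹ :=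
      sum_comm' fun s y => by grind
    _ ≤ ∑ y ∈ R, 1 := sum_le_sum fun y _ => by
      rw [sum_const, nsmul_eq_mul]
      exact mul_inv_le_one
    _ = #R := by simp
  exact_mod_cast hcount

theorem exists_eq_pair_of_mem {p : Finset α} (hp : #p = 2) {v : α} (hv : v ∈ p) :
    ∃ w, w ≠ v ∧ p = {v, w} := by
  obtain ⟨w, hw, rfl⟩ := exists_eq_insert_iff.2 ⟨singleton_subset_iff.2 hv, by simp [hp]⟩
  exact ⟨w, by simpa using hw, pair_comm w v⟩

theorem exists_eq_insert_of_subset {p D : Finset α} (hpD : p ⊆ D) (hcard : #p + 1 = #D) :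
    ∃ x ∉ p, D = insert x p := by
  obtain ⟨x, hx, rfl⟩ := exists_eq_insert_iff.2 ⟨hpD, hcard⟩
  exact ⟨x, hx, rfl⟩

theorem card_filter_mem_le_two_of_no_path {F : Finset (Finset α)} (hF : ∀ s ∈ F, #s = 2)
    (hpath : ∀ u y z t, [u, y, z, t].Nodup → {u, y} ∈ F → {y, z} ∈ F → {z, t} ∉ F)
    {y z : α} (hne : y ≠ z) (hyz : {y, z} ∈ F) (hz : 1 < #{s ∈ F | z ∈ s}) :
    #{s ∈ F | y ∈ s} ≤ 2 := by
  obtain ⟨s, hs, hs_ne⟩ := exists_mem_ne hz {y, z}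
  obtain ⟨hsF, hzs⟩ := mem_filter.1 hs
  obtain ⟨t, htz, rfl⟩ := exists_eq_pair_of_mem (hF s hsF) hzs
  -- If `z` lies on an edge `zt` with `t ≠ y`, then the edges at `y` can only be `yz` and `yt`.
  refine (card_le_card (t := {{y, z}, {y, t}}) fun e he => ?_).trans card_le_two
  obtain ⟨heF, hye⟩ := mem_filter.1 he
  obtain ⟨u, huy, rfl⟩ := exists_eq_pair_of_mem (hF e heF) hye
  by_contra hu
  simp only [mem_insert, mem_singleton, not_or] at hu
  have hty : t ≠ y := fun h => hs_ne (h ▸ pair_comm z t)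
  have huz : u ≠ z := fun h => hu.1 (h ▸ rfl)
  have hut : u ≠ t := fun h => hu.2 (h ▸ rfl)
  exact hpath u y z t (by simp [huy, huz, hut, hne, hty.symm, htz.symm]) (by rwa [pair_comm])
    hyz hsF

/-- A graph without a path on four vertices is a union of stars and triangles. -/
theorem card_le_card_of_no_path {F : Finset (Finset α)} {R : Finset α}
    (hF : F ⊆ R.powersetCard 2)
    (hpath : ∀ u y z t, [u, y, z, t].Nodup → {u, y} ∈ F → {y, z} ∈ F → {z, t} ∉ F) :
    #F ≤ #R := by
  have hF2 : ∀ s ∈ F, #s = 2 := fun s hs => (mem_powersetCard.1 (hF hs)).2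
  refine card_le_of_one_le_sum_inv_degree (fun s hs => (mem_powersetCard.1 (hF hs)).1)
    fun s hs => ?_
  obtain ⟨y, z, hyz, rfl⟩ := card_eq_two.1 (hF2 s hs)
  have hy_pos : 0 < #{t ∈ F | y ∈ t} := card_pos.2 ⟨_, mem_filter.2 ⟨hs, by simp⟩⟩
  have hz_pos : 0 < #{t ∈ F | z ∈ t} := card_pos.2 ⟨_, mem_filter.2 ⟨hs, by simp⟩⟩
  rw [sum_pair hyz]
  have half_le_inv {w : α} (hpos : 0 < #{t ∈ F | w ∈ t}) (hle : #{t ∈ F | w ∈ t} ≤ 2) :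
      (2 : ℚ)⁻¹ ≤ (#{t ∈ F | w ∈ t} : ℚ)⁻¹ :=
    inv_anti₀ (by exact_mod_cast hpos) (by exact_mod_cast hle)
  rcases Nat.lt_or_ge 1 #{t ∈ F | y ∈ t} with hy | hy
  swap
  · rw [le_antisymm hy hy_pos]
    simp
  rcases Nat.lt_or_ge 1 #{t ∈ F | z ∈ t} with hz | hz
  swap
  · rw [le_antisymm hz hz_pos]
    simp
  have hy_half := half_le_inv hy_pos (card_filter_mem_le_two_of_no_path hF2 hpath hyz hs hz)
  have hz_half := half_le_inv hz_pos
    (card_filter_mem_le_two_of_no_path hF2 hpath hyz.symm (by rwa [pair_comm]) hy)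
  linarith

end CountingLemmas

theorem card_filter_card_le {α : Type*} [Fintype α] (k : ℕ) :
    #{s : Finset α | #s ≤ k} = ∑ i ∈ range (k + 1), (Fintype.card α).choose i := by
  rw [card_eq_sum_card_fiberwise (f := card) (t := range (k + 1))
    fun s hs => by simpa [Nat.lt_succ_iff] using hs]
  refine sum_congr rfl fun i hi => ?_
  rw [← card_univ, ← card_powersetCard, filter_filter]
  congr 1
  ext s
  have := mem_range.1 hi
  simp only [mem_filter, mem_univ, true_and, mem_powersetCard, subset_univ]
  omega

namespace FinComplex

section Copies

variable {V W : Type*}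

theorem contains_of_card_le [Fintype W] {H : FinComplex V} (F : FinComplex W) {s : Finset V}
    (hs : s ∈ H.edges) (hcard : Fintype.card W ≤ #s) : H.Contains F := by
  obtain ⟨f⟩ : Nonempty (W ↪ s) := Function.Embedding.nonempty_of_card_le (by simpa using hcard)
  refine ⟨f.trans (Function.Embedding.subtype (· ∈ s)), fun e _ => H.down_closed s hs _ ?_⟩
  intro v hv
  obtain ⟨w, -, rfl⟩ := mem_map.1 hv
  exact (f w).2

theorem contains_generate [DecidableEq W] {H : FinComplex V} {G : Finset (Finset W)} :
    H.Contains (generate G) ↔ ∃ f : W ↪ V, ∀ g ∈ G, g.map f ∈ H.edges := by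
  refine exists_congr fun f => ⟨fun h g hg => h g ?_, fun h e he => ?_⟩
  · exact mem_biUnion.2 ⟨g, hg, mem_powerset_self g⟩
  · obtain ⟨g, hg, heg⟩ := mem_biUnion.1 he
    exact H.down_closed _ (h g hg) _ (map_subset_map.2 (mem_powerset.1 heg))

/-- The complex on `W` obtained by pulling `H` back along an injection. Along the inclusion of a
set of vertices it is the induced subcomplex, along a bijection it is a relabelling. -/
def comap [Fintype W] [DecidableEq V] (H : FinComplex V) (f : W ↪ V) : FinComplex W where
  edges := {e | e.map f ∈ H.edges}
  down_closed e he e' h := by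
    rw [mem_filter_univ] at he ⊢
    exact H.down_closed _ he _ (map_subset_map.2 h)

theorem Contains.of_comap [Fintype W] [DecidableEq V] {U : Type*} {H : FinComplex V}
    {F : FinComplex U} {f : W ↪ V} : (H.comap f).Contains F → H.Contains F := by
  rintro ⟨g, hg⟩
  refine ⟨g.trans f, fun e he => ?_⟩
  rw [← map_map]
  exact (mem_filter.1 (hg e he)).2

theorem card_comap_edges [Fintype W] [DecidableEq V] (H : FinComplex V) (f : W ↪ V) :
    #(H.comap f).edges = #{e ∈ H.edges | e ⊆ univ.map f} := by
  rw [← card_map (mapEmbedding f).toEmbedding]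
  congr 1
  ext e
  simp only [comap, mem_map, mem_filter, RelEmbedding.coe_toEmbedding,
    mapEmbedding_apply, subset_map_iff, subset_univ, true_and]
  grind

theorem card_edges_le_ex [Fintype V] {H : FinComplex V} {F : FinComplex W}
    (hF : F.edges.Nonempty) (hH : ¬ H.Contains F) : #H.edges ≤ ex (Fintype.card V) F := by
  classical
  let f := (Fintype.equivFin V).symm
  refine (ex_isGreatest _ F hF).2 ⟨H.comap f.toEmbedding, mt Contains.of_comap hH, ?_⟩
  rw [card_comap_edges, map_univ_equiv]
  simp

theorem contains_bowtie_iff [DecidableEq V] {H : FinComplex V} :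
    H.Contains bowtie ↔ ∃ a b c d e, [a, b, c, d, e].Nodup ∧
      {c, d} ∈ H.edges ∧ {a, b, c} ∈ H.edges ∧ {a, d, e} ∈ H.edges := by
  rw [bowtie, contains_generate]
  constructor
  · rintro ⟨f, hf⟩
    exact ⟨f 0, f 1, f 2, f 3, f 4, by simp, by simpa using hf⟩
  · rintro ⟨a, b, c, d, e, hnodup, hedges⟩
    have hinj : Function.Injective ![a, b, c, d, e] := List.nodup_ofFn.1 (by simpa using hnodup)
    exact ⟨⟨_, hinj⟩, by simpa using hedges⟩

end Copies

/-- The complexes without a copy of the bowtie. -/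
def BowtieFree {V : Type*} (H : FinComplex V) : Prop :=
  ¬ H.Contains bowtie

theorem BowtieFree.comap {V W : Type*} [Fintype W] [DecidableEq V] {H : FinComplex V}
    (hH : H.BowtieFree) (f : W ↪ V) : (H.comap f).BowtieFree :=
  mt Contains.of_comap hH

theorem BowtieFree.card_le_four {V : Type*} {H : FinComplex V} (hH : H.BowtieFree)
    {s : Finset V} (hs : s ∈ H.edges) : #s ≤ 4 := by
  by_contra! hcard
  exact hH (contains_of_card_le bowtie hs ((Fintype.card_fin 5).trans_le hcard))

theorem BowtieFree.pair_notMem {V : Type*} [DecidableEq V] {H : FinComplex V}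
    (hH : H.BowtieFree) {a b c d e : V} (hnodup : [a, b, c, d, e].Nodup)
    (habc : {a, b, c} ∈ H.edges) (hade : {a, d, e} ∈ H.edges) : {c, d} ∉ H.edges := fun hcd =>
  hH (contains_bowtie_iff.2 ⟨a, b, c, d, e, hnodup, hcd, habc, hade⟩)

/-- The triangles of `H`, that is, its edges of size `3`. -/
def triangles {V : Type*} (H : FinComplex V) : Finset (Finset V) :=
  {s ∈ H.edges | #s = 3}

theorem mem_triangles {V : Type*} {H : FinComplex V} {s : Finset V} :
    s ∈ H.triangles ↔ s ∈ H.edges ∧ #s = 3 :=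
  mem_filter

section Crossing

variable {V : Type*} [DecidableEq V] {H : FinComplex V} {D s : Finset V}

/-- The edges of `H` that meet `D`; these are the edges lost when `D` is deleted. -/
def meeting (H : FinComplex V) (D : Finset V) : Finset (Finset V) :=
  {s ∈ H.edges | ¬ Disjoint s D}

/-- The edges of `H` with `i` vertices in `D` and `j` vertices outside `D`. -/
def crossing (H : FinComplex V) (D : Finset V) (i j : ℕ) : Finset (Finset V) :=
  {s ∈ H.edges | #(s ∩ D) = i ∧ #(s \ D) = j}

theorem mem_crossing {i j : ℕ} :
    s ∈ H.crossing D i j ↔ s ∈ H.edges ∧ #(s ∩ D) = i ∧ #(s \ D) = j :=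
  mem_filter

theorem BowtieFree.pair_notMem_of_mem_triangles (hH : H.BowtieFree) (hD : D ∈ H.triangles)
    (hs : s ∈ H.edges) {u v y z : V} (hv : v ∈ s ∩ D) (hy : y ∈ s \ D) (hz : z ∈ s \ D)
    (hyz : y ≠ z) (hu : u ∈ D) (huv : u ≠ v) : {u, y} ∉ H.edges := by
  obtain ⟨hDE, hD3⟩ := mem_triangles.1 hD
  obtain ⟨hvs, hvD⟩ := mem_inter.1 hv
  obtain ⟨w, hw, rfl⟩ := exists_eq_insert_of_subset (p := {v, u}) (D := D) (by grind)
    (by rw [card_pair huv.symm, hD3])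
  refine hH.pair_notMem (a := v) (b := w) (e := z) ?_ (by rwa [insert_comm] at hDE)
    (H.down_closed s hs _ (by grind))
  grind

theorem BowtieFree.card_inter_le_one (hH : H.BowtieFree) (hD : D ∈ H.triangles)
    (hs : s ∈ H.edges) (h2 : 2 ≤ #(s \ D)) : #(s ∩ D) ≤ 1 := by
  obtain ⟨y, hy, z, hz, hyz⟩ := one_lt_card.1 h2
  refine card_le_one.2 fun v hv u hu => ?_
  by_contra hvu
  exact hH.pair_notMem_of_mem_triangles hD hs hv hy hz hyz (mem_inter.1 hu).2 (Ne.symm hvu)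
    (H.down_closed s hs _ (by grind))

theorem exists_insert_sdiff_eq {j : ℕ} (hs : s ∈ H.crossing D 1 j) :
    ∃ v ∈ D, insert v (s \ D) = s := by
  obtain ⟨v, hv⟩ := card_eq_one.1 (mem_crossing.1 hs).2.1
  refine ⟨v, (mem_inter.1 (hv ▸ mem_singleton_self v)).2, ?_⟩
  rw [insert_eq, ← hv, union_comm, sdiff_union_inter]

theorem BowtieFree.injOn_sdiff_crossing (hH : H.BowtieFree) (hD : D ∈ H.triangles) {j : ℕ}
    (hj : 2 ≤ j) : Set.InjOn (· \ D) (H.crossing D 1 j : Set (Finset V)) := by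
  intro s hs t ht hst
  change s \ D = t \ D at hst
  obtain ⟨v, hv, hvs⟩ := exists_insert_sdiff_eq hs
  obtain ⟨u, hu, hut⟩ := exists_insert_sdiff_eq ht
  obtain ⟨hsE, -, hsj⟩ := mem_crossing.1 hs
  obtain ⟨htE, -⟩ := mem_crossing.1 ht
  obtain ⟨y, hy, z, hz, hyz⟩ := one_lt_card.1 (show 1 < #(s \ D) by omega)
  have hvu : v = u := by
    by_contra hne
    exact hH.pair_notMem_of_mem_triangles hD hsE (v := v) (by grind) hy hz hyz hu (Ne.symm hne)
      (H.down_closed t htE _ (by grind))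
  rw [← hvs, ← hut, hvu, hst]

theorem BowtieFree.meeting_subset (hH : H.BowtieFree) (hD : D ∈ H.triangles) :
    H.meeting D ⊆ D.powerset.erase ∅ ∪ (H.crossing D 1 1 ∪ H.crossing D 1 2 ∪ H.crossing D 1 3 ∪
      H.crossing D 2 1 ∪ H.crossing D 3 1) := by
  intro s hs
  obtain ⟨hsE, hsD⟩ := mem_filter.1 hs
  have hinter : 0 < #(s ∩ D) := card_pos.2 (not_disjoint_iff_nonempty_inter.1 hsD)
  have hinter_le : #(s ∩ D) ≤ 3 :=
    (card_le_card inter_subset_right).trans (mem_triangles.1 hD).2.le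
  have hcard : #(s \ D) + #(s ∩ D) ≤ 4 := by
    rw [card_sdiff_add_card_inter]
    exact hH.card_le_four hsE
  have hinter_one := hH.card_inter_le_one hD hsE
  rcases (s \ D).eq_empty_or_nonempty with hempty | hnonempty
  · have hne : s ≠ ∅ := by rintro rfl; simp at hsD
    exact mem_union_left _ (mem_erase.2 ⟨hne, mem_powerset.2 (sdiff_eq_empty_iff_subset.1 hempty)⟩)
  · have hpos := card_pos.2 hnonempty
    simp only [mem_union, mem_crossing, hsE, true_and]
    omega

end Crossing

section Pages

variable {V : Type*} [Fintype V] [DecidableEq V] {H : FinComplex V} {D p q s : Finset V}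
  {u v x y : V}

/-- The pages of a set `p` are the vertices that extend `p` to a larger edge. -/
def pages (H : FinComplex V) (p : Finset V) : Finset V :=
  {x | x ∉ p ∧ insert x p ∈ H.edges}

theorem mem_pages : x ∈ H.pages p ↔ x ∉ p ∧ insert x p ∈ H.edges :=
  mem_filter_univ x

/-- The spines of `H` are the pairs with at least three pages. -/
def spines (H : FinComplex V) : Finset (Finset V) :=
  {p | #p = 2 ∧ 3 ≤ #(H.pages p)}

theorem mem_spines : p ∈ H.spines ↔ #p = 2 ∧ 3 ≤ #(H.pages p) :=
  mem_filter_univ p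

theorem exists_mem_pages_notMem (hp : p ∈ H.spines) {t : Finset V} (ht : #t ≤ 2) :
    ∃ u ∈ H.pages p, u ∉ t :=
  exists_mem_notMem_of_card_lt_card (ht.trans_lt (mem_spines.1 hp).2)

theorem insert_mem_triangles (hp : #p = 2) (hx : x ∈ H.pages p) : insert x p ∈ H.triangles := by
  obtain ⟨hxp, hE⟩ := mem_pages.1 hx
  exact mem_triangles.2 ⟨hE, by rw [card_insert_of_notMem hxp, hp]⟩

theorem exists_mem_pages_eq_insert (hD : D ∈ H.triangles) (hpD : p ⊆ D) (hp : #p = 2) :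
    ∃ x ∈ H.pages p, D = insert x p := by
  obtain ⟨hDE, hD3⟩ := mem_triangles.1 hD
  obtain ⟨x, hxp, rfl⟩ := exists_eq_insert_of_subset hpD (by rw [hp, hD3])
  exact ⟨x, mem_pages.2 ⟨hxp, hDE⟩, rfl⟩

theorem card_pages_sdiff_add_one_le (hD : D ∈ H.triangles) (hpD : p ⊆ D) (hp : #p = 2) :
    #(H.pages p \ D) + 1 ≤ #(H.pages p) := by
  obtain ⟨x, hx, rfl⟩ := exists_mem_pages_eq_insert hD hpD hp
  exact card_lt_card ((ssubset_iff_of_subset sdiff_subset).2 ⟨x, hx, by simp⟩)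

theorem BowtieFree.pages_subset_of_ne (hH : H.BowtieFree) (hp : p ∈ H.spines)
    (hx : x ∈ H.pages p) (hqx : q ⊆ insert x p) (hq : #q = 2) (hqp : q ≠ p) : H.pages q ⊆ p := by
  obtain ⟨hp2, -⟩ := mem_spines.1 hp
  obtain ⟨hxp, hxpE⟩ := mem_pages.1 hx
  have hxq : x ∈ q := by
    by_contra hxq
    exact hqp (eq_of_subset_of_card_le ((subset_insert_iff_of_notMem hxq).1 hqx) (by rw [hp2, hq]))
  obtain ⟨v, hvx, rfl⟩ := exists_eq_pair_of_mem hq hxq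
  obtain ⟨w, hwv, rfl⟩ := exists_eq_pair_of_mem
    hp2 (mem_of_mem_insert_of_ne (hqx (by simp)) hvx)
  intro y hy
  obtain ⟨hyq, hyqE⟩ := mem_pages.1 hy
  by_contra hyp
  obtain ⟨u, hu, huxy⟩ := exists_mem_pages_notMem hp (card_le_two (a := x) (b := y))
  obtain ⟨hup, hupE⟩ := mem_pages.1 hu
  refine hH.pair_notMem (a := v) (b := u) (c := w) (d := x) (e := y) ?_ ?_ ?_
    (H.down_closed _ hxpE _ ?_)
  · grind
  · rwa [insert_comm] at hupE
  · convert hyqE using 1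
    grind
  · grind

theorem BowtieFree.spine_eq_of_subset (hH : H.BowtieFree) (hD : D ∈ H.triangles)
    (hp : p ∈ H.spines) (hpD : p ⊆ D) (hq : q ∈ H.spines) (hqD : q ⊆ D) : q = p := by
  obtain ⟨hp2, -⟩ := mem_spines.1 hp
  obtain ⟨hq2, hq3⟩ := mem_spines.1 hq
  obtain ⟨x, hx, rfl⟩ := exists_mem_pages_eq_insert hD hpD hp2
  by_contra hqp
  have := card_le_card (hH.pages_subset_of_ne hp hx hqD hq2 hqp)
  omega

theorem BowtieFree.card_le_three_of_spine_subset (hH : H.BowtieFree) (hs : s ∈ H.edges)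
    (hp : p ∈ H.spines) (hps : p ⊆ s) : #s ≤ 3 := by
  by_contra! hcard
  obtain ⟨hp2, -⟩ := mem_spines.1 hp
  obtain ⟨c, hc, d, hd, hcd⟩ := one_lt_card.1 (show 1 < #(s \ p) by
    rw [card_sdiff_of_subset hps]; omega)
  obtain ⟨u, hu, hucd⟩ := exists_mem_pages_notMem hp (card_le_two (a := c) (b := d))
  obtain ⟨hup, hupE⟩ := mem_pages.1 hu
  obtain ⟨a, b, hab, rfl⟩ := card_eq_two.1 hp2
  refine hH.pair_notMem (a := a) (b := u) (c := b) (d := c) (e := d) ?_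
    (by rwa [insert_comm] at hupE) (H.down_closed s hs _ ?_) (H.down_closed s hs _ ?_) <;> grind

end Pages

section Outer

variable {V : Type*} [Fintype V] [DecidableEq V] {H : FinComplex V} {D p s t : Finset V}
  {u v y z : V}

/-- The vertices outside `D` that lie in an edge with one vertex in `D` and two outside. In a
bowtie-free complex they are adjacent to only one vertex of the triangle `D`. -/
def outer (H : FinComplex V) (D : Finset V) : Finset V :=
  {y | y ∉ D ∧ ∃ v ∈ D, ∃ z ∉ D, z ≠ y ∧ {v, y, z} ∈ H.edges}

theorem mem_outer :
    y ∈ H.outer D ↔ y ∉ D ∧ ∃ v ∈ D, ∃ z ∉ D, z ≠ y ∧ {v, y, z} ∈ H.edges :=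
  mem_filter_univ y

theorem outer_subset_compl : H.outer D ⊆ Dᶜ := fun _ hy =>
  mem_compl.2 (mem_outer.1 hy).1

theorem sdiff_subset_outer (hs : s ∈ H.edges) (hsD : (s ∩ D).Nonempty) (h2 : 2 ≤ #(s \ D)) :
    s \ D ⊆ H.outer D := by
  intro y hy
  obtain ⟨v, hv⟩ := hsD
  obtain ⟨z, hz, hzy⟩ := exists_mem_ne h2 y
  obtain ⟨hvs, hvD⟩ := mem_inter.1 hv
  obtain ⟨hys, hyD⟩ := mem_sdiff.1 hy
  obtain ⟨hzs, hzD⟩ := mem_sdiff.1 hz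
  exact mem_outer.2 ⟨hyD, v, hvD, z, hzD, hzy, H.down_closed s hs _ (by grind)⟩

theorem BowtieFree.eq_of_mem_outer (hH : H.BowtieFree) (hD : D ∈ H.triangles)
    (hy : y ∈ H.outer D) (hu : u ∈ D) (huy : {u, y} ∈ H.edges) (hv : v ∈ D)
    (hvy : {v, y} ∈ H.edges) : u = v := by
  obtain ⟨hyD, w, hw, z, hzD, hzy, hwyz⟩ := mem_outer.1 hy
  have eq_w {x : V} (hx : x ∈ D) (hxy : {x, y} ∈ H.edges) : x = w := by
    by_contra hxw
    refine hH.pair_notMem_of_mem_triangles hD hwyz (z := z) ?_ ?_ ?_ hzy.symm hx hxw hxy <;> grind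
  rw [eq_w hu huy, eq_w hv hvy]

theorem BowtieFree.disjoint_pages_outer (hH : H.BowtieFree) (hD : D ∈ H.triangles)
    (hpD : p ⊆ D) (hp : #p = 2) : Disjoint (H.pages p) (H.outer D) := by
  refine disjoint_left.2 fun y hy hy_outer => ?_
  obtain ⟨u, v, huv, rfl⟩ := card_eq_two.1 hp
  obtain ⟨-, hE⟩ := mem_pages.1 hy
  exact huv (hH.eq_of_mem_outer hD hy_outer (hpD (by simp)) (H.down_closed _ hE _ (by grind))
    (hpD (by simp)) (H.down_closed _ hE _ (by grind)))

theorem card_crossing_le_sum_card_pages_sdiff (k : ℕ) :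
    #(H.crossing D k 1) ≤ ∑ p ∈ D.powersetCard k, #(H.pages p \ D) := by
  have hcover : H.crossing D k 1 ⊆
      (D.powersetCard k).biUnion fun p => (H.pages p \ D).image fun y => insert y p := by
    intro s hs
    obtain ⟨hsE, hk, h1⟩ := mem_crossing.1 hs
    obtain ⟨y, hy⟩ := card_eq_one.1 h1
    have hyD : y ∈ s \ D := by simp [hy]
    have hinsert : insert y (s ∩ D) = s := by
      rw [insert_eq, ← hy, sdiff_union_inter]
    refine mem_biUnion.2 ⟨s ∩ D, mem_powersetCard.2 ⟨inter_subset_right, hk⟩,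
      mem_image.2 ⟨y, mem_sdiff.2 ⟨mem_pages.2 ⟨?_, by rwa [hinsert]⟩, ?_⟩, hinsert⟩⟩ <;> grind
  exact (card_le_card hcover).trans (card_biUnion_le.trans (sum_le_sum fun _ _ => card_image_le))

theorem BowtieFree.card_crossing_one_one_add_le (hH : H.BowtieFree) (hD : D ∈ H.triangles) :
    #(H.crossing D 1 1) + 2 * #(H.outer D) ≤ 3 * #Dᶜ := by
  have hcount : #(H.crossing D 1 1) ≤ ∑ y ∈ Dᶜ, #{v ∈ D | {v, y} ∈ H.edges} := calc
    #(H.crossing D 1 1) ≤ ∑ v ∈ D, #(H.pages {v} \ D) := by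
      simpa [powersetCard_one] using card_crossing_le_sum_card_pages_sdiff (H := H) (D := D) 1
    _ = ∑ v ∈ D, #{y ∈ Dᶜ | {v, y} ∈ H.edges} := sum_congr rfl fun v hv => by
      congr 1
      ext y
      simp only [mem_sdiff, mem_pages, mem_filter, mem_compl, mem_singleton, pair_comm y v]
      grind
    _ = _ := sum_card_bipartiteAbove_eq_sum_card_bipartiteBelow _
  have hdegree {y : V} (hy : y ∈ H.outer D) : #{v ∈ D | {v, y} ∈ H.edges} ≤ 1 := by
    refine card_le_one.2 fun u hu v hv => ?_
    exact hH.eq_of_mem_outer hD hy (mem_filter.1 hu).1 (mem_filter.1 hu).2 (mem_filter.1 hv).1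
      (mem_filter.1 hv).2
  calc #(H.crossing D 1 1) + 2 * #(H.outer D)
      ≤ ∑ y ∈ Dᶜ, #{v ∈ D | {v, y} ∈ H.edges} + ∑ y ∈ Dᶜ, if y ∈ H.outer D then 2 else 0 := by
        gcongr
        rw [← sum_filter, sum_const, smul_eq_mul, mul_comm,
          filter_mem_eq_inter, inter_eq_right.2 outer_subset_compl]
    _ = ∑ y ∈ Dᶜ, (#{v ∈ D | {v, y} ∈ H.edges} + if y ∈ H.outer D then 2 else 0) :=
        sum_add_distrib.symm
    _ ≤ ∑ y ∈ Dᶜ, 3 := sum_le_sum fun y _ => by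
        split_ifs with hy
        · exact Nat.add_le_add_right (hdegree hy) 2
        · exact (card_filter_le _ _).trans (mem_triangles.1 hD).2.le
    _ = 3 * #Dᶜ := by rw [sum_const, smul_eq_mul, mul_comm]

theorem sdiff_subset_outer_of_mem_crossing {j : ℕ} (hs : s ∈ H.crossing D 1 j) (hj : 2 ≤ j) :
    s \ D ⊆ H.outer D := by
  obtain ⟨hsE, h1, h2⟩ := mem_crossing.1 hs
  exact sdiff_subset_outer hsE (card_pos.1 (by omega)) (h2 ▸ hj)

theorem BowtieFree.card_crossing_one_two_le (hH : H.BowtieFree) (hD : D ∈ H.triangles) :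
    #(H.crossing D 1 2) ≤ #(H.outer D) := by
  have exists_apex {e : Finset V} (he : e ∈ (H.crossing D 1 2).image (· \ D)) :
      (∃ v ∈ D, insert v e ∈ H.edges) ∧ e ∈ (H.outer D).powersetCard 2 := by
    obtain ⟨s, hs, rfl⟩ := mem_image.1 he
    obtain ⟨v, hv, hvs⟩ := exists_insert_sdiff_eq hs
    obtain ⟨hsE, -, h2⟩ := mem_crossing.1 hs
    exact ⟨⟨v, hv, by rwa [hvs]⟩, mem_powersetCard.2
      ⟨sdiff_subset_outer_of_mem_crossing hs le_rfl, h2⟩⟩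
  rw [← card_image_of_injOn (hH.injOn_sdiff_crossing hD le_rfl)]
  refine card_le_card_of_no_path (fun e he => (exists_apex he).2)
    fun u y z t hnodup huy hyz hzt => ?_
  -- The three edges of a path have the same apex `v`, which is the centre of a bowtie.
  obtain ⟨⟨v, hv, hvyz⟩, hyz_outer⟩ := exists_apex hyz
  obtain ⟨⟨a, ha, hauy⟩, huy_outer⟩ := exists_apex huy
  obtain ⟨⟨b, hb, hbzt⟩, hzt_outer⟩ := exists_apex hzt
  simp only [mem_powersetCard, insert_subset_iff, singleton_subset_iff] at *
  have hav : a = v := hH.eq_of_mem_outer hD hyz_outer.1.1 ha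
    (H.down_closed _ hauy _ (by grind)) hv (H.down_closed _ hvyz _ (by grind))
  have hbv : b = v := hH.eq_of_mem_outer hD hyz_outer.1.2 hb
    (H.down_closed _ hbzt _ (by grind)) hv (H.down_closed _ hvyz _ (by grind))
  subst hav hbv
  have notMem_D {x : V} (hx : x ∈ H.outer D) : x ∉ D := (mem_outer.1 hx).1
  refine hH.pair_notMem ?_ hauy hbzt (H.down_closed _ hvyz _ (subset_insert _ _))
  grind

theorem BowtieFree.card_crossing_one_three_le (hH : H.BowtieFree) (hD : D ∈ H.triangles) :
    #(H.crossing D 1 3) ≤ #(H.outer D) := by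
  refine card_le_card_of_forall_subsingleton (fun s y => y ∈ s) (fun s hs => ?_)
    fun y hy s hs t ht => ?_
  · obtain ⟨y, hy⟩ : (s \ D).Nonempty := card_pos.1 (by rw [(mem_crossing.1 hs).2.2]; simp)
    exact ⟨y, sdiff_subset_outer_of_mem_crossing hs (by simp) hy, (mem_sdiff.1 hy).1⟩
  obtain ⟨hs, hys⟩ := hs
  obtain ⟨ht, hyt⟩ := ht
  by_contra hst
  obtain ⟨hsE, -, hs3⟩ := mem_crossing.1 hs
  obtain ⟨htE, -, ht3⟩ := mem_crossing.1 ht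
  obtain ⟨v, hv, hvs⟩ := exists_insert_sdiff_eq hs
  obtain ⟨u, hu, hut⟩ := exists_insert_sdiff_eq ht
  have hyD : y ∉ D := (mem_outer.1 hy).1
  have hvu : v = u := hH.eq_of_mem_outer hD hy hv (H.down_closed s hsE _ (by grind)) hu
    (H.down_closed t htE _ (by grind))
  obtain ⟨x, hxt, hxs⟩ : ∃ x ∈ t \ D, x ∉ s \ D := by
    by_contra! hts
    have := eq_of_subset_of_card_le hts (by omega)
    exact hst (by rw [← hvs, ← hut, hvu, this])
  obtain ⟨z, hz, w, hw, hzw⟩ := one_lt_card.1 (show 1 < #((s \ D).erase y) by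
    rw [card_erase_of_mem (mem_sdiff.2 ⟨hys, hyD⟩)]; omega)
  refine hH.pair_notMem (a := y) (b := w) (c := z) (d := v) (e := x) ?_
    (H.down_closed s hsE _ ?_) (H.down_closed t htE _ ?_) (H.down_closed s hsE _ ?_) <;> grind

theorem BowtieFree.card_meeting_add_le (hH : H.BowtieFree) (hD : D ∈ H.triangles) :
    #(H.meeting D) + #(H.outer D) + 2 ≤ 3 * Fintype.card V +
      (#(H.crossing D 2 1) + #(H.crossing D 3 1)) + #(H.crossing D 1 3) := by
  obtain ⟨-, hD3⟩ := mem_triangles.1 hD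
  have hinside : #(D.powerset.erase ∅) = 7 := by
    rw [card_erase_of_mem (empty_mem_powerset D), card_powerset, hD3]
    rfl
  have hle : #(H.meeting D) ≤ 7 + (#(H.crossing D 1 1) + #(H.crossing D 1 2) +
      #(H.crossing D 1 3) + #(H.crossing D 2 1) + #(H.crossing D 3 1)) := by
    rw [← hinside]
    refine (card_le_card (hH.meeting_subset hD)).trans ((card_union_le _ _).trans ?_)
    gcongr
    refine (card_union_le _ _).trans ?_
    gcongr
    refine (card_union_le _ _).trans ?_
    gcongr
    refine (card_union_le _ _).trans ?_
    gcongr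
    exact card_union_le _ _
  have h11 := hH.card_crossing_one_one_add_le hD
  have h12 := hH.card_crossing_one_two_le hD
  have hcompl := card_add_card_compl D
  omega

end Outer

section Spine

variable {V : Type*} [Fintype V] [DecidableEq V] {H : FinComplex V} {D p : Finset V}

theorem card_crossing_three_one_le (hD : D ∈ H.triangles) (hpD : p ⊆ D) :
    #(H.crossing D 3 1) ≤ #(H.pages p \ D) := by
  obtain ⟨-, hD3⟩ := mem_triangles.1 hD
  have hle := card_crossing_le_sum_card_pages_sdiff (H := H) (D := D) 3
  rw [← hD3, powersetCard_self, sum_singleton, hD3] at hle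
  refine hle.trans (card_le_card fun x hx => ?_)
  obtain ⟨hx, hxD⟩ := mem_sdiff.1 hx
  obtain ⟨-, hE⟩ := mem_pages.1 hx
  exact mem_sdiff.2 ⟨mem_pages.2 ⟨fun h => hxD (hpD h),
    H.down_closed _ hE _ (insert_subset_insert x hpD)⟩, hxD⟩

theorem card_crossing_le_of_no_spine (hD : D ∈ H.triangles) (hspine : ∀ p ∈ H.spines, ¬ p ⊆ D) :
    #(H.crossing D 2 1) + #(H.crossing D 3 1) ≤ 4 := by
  obtain ⟨-, hD3⟩ := mem_triangles.1 hD
  have hpages {p : Finset V} (hpD : p ⊆ D) (hp : #p = 2) : #(H.pages p \ D) ≤ 1 := by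
    have hfew : #(H.pages p) < 3 := by
      by_contra! h
      exact hspine p (mem_spines.2 ⟨hp, h⟩) hpD
    have := card_pages_sdiff_add_one_le hD hpD hp
    omega
  have h21 : #(H.crossing D 2 1) ≤ 3 := calc
    #(H.crossing D 2 1) ≤ ∑ p ∈ D.powersetCard 2, #(H.pages p \ D) :=
      card_crossing_le_sum_card_pages_sdiff 2
    _ ≤ ∑ p ∈ D.powersetCard 2, 1 := sum_le_sum fun p hp =>
      hpages (mem_powersetCard.1 hp).1 (mem_powersetCard.1 hp).2
    _ = 3 := by simp [hD3]
  obtain ⟨p, hpD, hp⟩ := exists_subset_card_eq (show 2 ≤ #D by omega)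
  have h31 := (card_crossing_three_one_le hD hpD).trans (hpages hpD hp)
  omega

theorem BowtieFree.card_crossing_lt_card_pages (hH : H.BowtieFree) (hD : D ∈ H.triangles)
    (hp : p ∈ H.spines) (hpD : p ⊆ D) :
    #(H.crossing D 2 1) + #(H.crossing D 3 1) < #(H.pages p) := by
  obtain ⟨hp2, -⟩ := mem_spines.1 hp
  have h31 : #(H.crossing D 3 1) = 0 := by
    refine card_eq_zero.2 (eq_empty_of_forall_notMem fun s hs => ?_)
    obtain ⟨hsE, hs3, hs1⟩ := mem_crossing.1 hs
    have hDs : D ⊆ s := by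
      rw [← eq_of_subset_of_card_le inter_subset_right ((mem_triangles.1 hD).2.trans_le hs3.ge)]
      exact inter_subset_left
    have hs_le := hH.card_le_three_of_spine_subset hsE hp (hpD.trans hDs)
    have := card_sdiff_add_card_inter s D
    omega
  have h21 : #(H.crossing D 2 1) ≤ #(H.pages p \ D) := by
    refine (card_crossing_le_sum_card_pages_sdiff 2).trans_eq
      (sum_eq_single_of_mem p (mem_powersetCard.2 ⟨hpD, hp2⟩) fun q hq hqp => ?_)
    obtain ⟨hqD, hq2⟩ := mem_powersetCard.1 hq
    obtain ⟨x, hx, rfl⟩ := exists_mem_pages_eq_insert hD hpD hp2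
    exact card_eq_zero.2 (sdiff_eq_empty_iff_subset.2
      ((hH.pages_subset_of_ne hp hx hqD hq2 hqp).trans (subset_insert x p)))
  have := card_pages_sdiff_add_one_le hD hpD hp2
  omega

end Spine

section Irreducible

variable {V : Type*} [Fintype V] [DecidableEq V] {H : FinComplex V} {D p q s : Finset V}
  {a c x : V}

/-- The bowtie-free complexes to which the inductive step of the upper bound does not apply: they
have at least `13` vertices, and the deletion of any triangle costs more than the difference
`(54 n - 45) / 16` between the values of `(9 n ^ 2 + 12 n) / 16` at `n` and `n - 3`. -/
structure Irreducible (H : FinComplex V) : Prop where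
  bowtieFree : H.BowtieFree
  le_card : 13 ≤ Fintype.card V
  lt_card_meeting : ∀ D ∈ H.triangles, 54 * Fintype.card V < 16 * #(H.meeting D) + 45

namespace Irreducible

theorem exists_spine_subset (hH : H.Irreducible) (hD : D ∈ H.triangles) :
    ∃ p ∈ H.spines, p ⊆ D := by
  by_contra! hspine
  have := hH.le_card
  have := hH.lt_card_meeting D hD
  have := hH.bowtieFree.card_meeting_add_le hD
  have := hH.bowtieFree.card_crossing_one_three_le hD
  have := card_crossing_le_of_no_spine hD hspine
  omega

theorem card_le_three (hH : H.Irreducible) (hs : s ∈ H.edges) : #s ≤ 3 := by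
  by_contra! hcard
  obtain ⟨D, hDs, hD3⟩ := exists_subset_card_eq hcard.le
  obtain ⟨p, hp, hpD⟩ :=
    hH.exists_spine_subset (mem_triangles.2 ⟨H.down_closed s hs D hDs, hD3⟩)
  have := hH.bowtieFree.card_le_three_of_spine_subset hs hp (hpD.trans hDs)
  omega

theorem lt_card_pages_of_subset (hH : H.Irreducible) (hD : D ∈ H.triangles) (hp : p ∈ H.spines)
    (hpD : p ⊆ D) : 6 * Fintype.card V + 3 + 16 * #(H.outer D) < 16 * #(H.pages p) := by
  have h13 : #(H.crossing D 1 3) = 0 := by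
    refine card_eq_zero.2 (eq_empty_of_forall_notMem fun s hs => ?_)
    obtain ⟨hsE, h1, h3⟩ := mem_crossing.1 hs
    have := card_sdiff_add_card_inter s D
    have := hH.card_le_three hsE
    omega
  have := hH.lt_card_meeting D hD
  have := hH.bowtieFree.card_meeting_add_le hD
  have := hH.bowtieFree.card_crossing_lt_card_pages hD hp hpD
  omega

theorem lt_card_pages (hH : H.Irreducible) (hp : p ∈ H.spines) :
    6 * Fintype.card V + 3 < 16 * #(H.pages p) := by
  obtain ⟨x, hx, -⟩ := exists_mem_pages_notMem hp (t := ∅) (by simp)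
  have := hH.lt_card_pages_of_subset (insert_mem_triangles (mem_spines.1 hp).1 hx) hp
    (subset_insert x p)
  omega

theorem not_pages_subset_outer (hH : H.Irreducible) (hD : D ∈ H.triangles) (hq : q ∈ H.spines) :
    ¬ H.pages q ⊆ H.outer D := by
  intro hsub
  obtain ⟨p, hp, hpD⟩ := hH.exists_spine_subset hD
  have hq_le := card_le_card hsub
  have hq_lt := hH.lt_card_pages hq
  have hp_lt := hH.lt_card_pages_of_subset hD hp hpD
  have hdisj : #(H.pages p) + #(H.outer D) ≤ Fintype.card V := by
    rw [← card_union_of_disjoint (hH.bowtieFree.disjoint_pages_outer hD hpD (mem_spines.1 hp).1)]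
    exact card_le_univ _
  omega

theorem spine_subset_or_disjoint (hH : H.Irreducible) (hD : D ∈ H.triangles)
    (hq : q ∈ H.spines) : q ⊆ D ∨ Disjoint D q := by
  by_contra! hcon
  obtain ⟨hqD, hDq⟩ := hcon
  obtain ⟨v, hvD, hvq⟩ := not_disjoint_iff.1 hDq
  obtain ⟨w, hwv, rfl⟩ := exists_eq_pair_of_mem (mem_spines.1 hq).1 hvq
  have hwD : w ∉ D := fun hwD => hqD (by grind)
  refine hH.not_pages_subset_outer hD hq fun y hy => ?_
  obtain ⟨hyq, hyE⟩ := mem_pages.1 hy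
  have hvy : v ≠ y := by grind
  by_cases hyD : y ∈ D
  · -- The third vertex of `D` is a page of `vy`, hence lies in the spine `vw`.
    obtain ⟨t, ht, rfl⟩ := exists_mem_pages_eq_insert (p := {v, y}) hD (by grind) (card_pair hvy)
    have htq : t ∈ ({v, w} : Finset V) :=
      hH.bowtieFree.pages_subset_of_ne hq hy (by grind) (card_pair hvy) (by grind) ht
    have := (mem_pages.1 ht).1
    grind
  · exact mem_outer.2 ⟨hyD, v, hvD, w, hwD, by grind, by
      convert hyE using 1
      grind⟩

theorem disjoint_of_ne (hH : H.Irreducible) (hp : p ∈ H.spines) (hq : q ∈ H.spines)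
    (hpq : p ≠ q) (hx : x ∈ H.pages p) : Disjoint (insert x p) q := by
  have hD := insert_mem_triangles (mem_spines.1 hp).1 hx
  refine (hH.spine_subset_or_disjoint hD hq).resolve_left fun hqD => hpq.symm ?_
  exact hH.bowtieFree.spine_eq_of_subset hD hp (subset_insert x p) hq hqD

theorem pairwiseDisjoint_spines (hH : H.Irreducible) :
    (H.spines : Set (Finset V)).PairwiseDisjoint id := by
  intro p hp q hq hpq
  obtain ⟨x, hx, -⟩ := exists_mem_pages_notMem hp (t := ∅) (by simp)
  exact (disjoint_insert_left.1 (hH.disjoint_of_ne hp hq hpq hx)).2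

theorem pair_notMem_of_mem_pages (hH : H.Irreducible) (hp : p ∈ H.spines) (hq : q ∈ H.spines)
    (hpq : p ≠ q) (ha : a ∈ p) (hc : c ∈ q) (hxp : x ∈ H.pages p) (hxq : x ∈ H.pages q) :
    {a, c} ∉ H.edges := by
  have hdisj := hH.disjoint_of_ne hp hq hpq hxp
  obtain ⟨b, hb, rfl⟩ := exists_eq_pair_of_mem (mem_spines.1 hp).1 ha
  obtain ⟨d, hd, rfl⟩ := exists_eq_pair_of_mem (mem_spines.1 hq).1 hc
  rw [mem_pages, pair_comm a b] at hxp
  rw [mem_pages] at hxq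
  simp only [disjoint_insert_left, disjoint_singleton_left, mem_insert, mem_singleton,
    not_or] at hdisj
  refine hH.bowtieFree.pair_notMem ?_ hxp.2 hxq.2
  grind

theorem disjoint_pages_biUnion_spines (hH : H.Irreducible) (hp : p ∈ H.spines) :
    Disjoint (H.pages p) (H.spines.biUnion id) := by
  refine (disjoint_biUnion_right _ _ _).2 fun q hq => disjoint_left.2 fun x hx hxq => ?_
  by_cases hpq : p = q
  · exact (mem_pages.1 hx).1 (hpq ▸ hxq)
  · exact disjoint_left.1 (hH.disjoint_of_ne hp hq hpq hx) (mem_insert_self x p) hxq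

theorem card_biUnion_spines (hH : H.Irreducible) {S : Finset (Finset V)} (hS : S ⊆ H.spines) :
    #(S.biUnion id) = 2 * #S := by
  rw [card_biUnion (fun p hp q hq hpq => hH.pairwiseDisjoint_spines (hS hp) (hS hq) hpq),
    sum_const_nat (f := fun p => #(id p)) fun p hp => (mem_spines.1 (hS hp)).1, mul_comm]

end Irreducible

/-- The spines whose pages are disjoint from the pages of some spine. Edges between two spines
can only occur among these. -/
def separatedSpines (H : FinComplex V) : Finset (Finset V) :=
  {p ∈ H.spines | ∃ q ∈ H.spines, Disjoint (H.pages p) (H.pages q)}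

theorem mem_separatedSpines :
    p ∈ H.separatedSpines ↔ p ∈ H.spines ∧ ∃ q ∈ H.spines, Disjoint (H.pages p) (H.pages q) :=
  mem_filter

namespace Irreducible

theorem pairs_subset (hH : H.Irreducible) :
    {s ∈ H.edges | #s = 2} ⊆
      (univ.powersetCard 2 \ (H.spines.biUnion id).powersetCard 2 ∪ H.spines) ∪
        (H.separatedSpines.biUnion id).powersetCard 2 := by
  intro s hs
  obtain ⟨hsE, hs2⟩ := mem_filter.1 hs
  by_cases hsU : s ⊆ H.spines.biUnion id
  swap
  · simp [hs2, hsU]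
  obtain ⟨x, y, -, rfl⟩ := card_eq_two.1 hs2
  simp only [insert_subset_iff, singleton_subset_iff, mem_biUnion, id_eq] at hsU
  obtain ⟨⟨p, hp, hxp⟩, q, hq, hyq⟩ := hsU
  obtain rfl | hpq := eq_or_ne p q
  · have hsp : {x, y} = p := eq_of_subset_of_card_le (by grind) (by rw [(mem_spines.1 hp).1, hs2])
    exact mem_union_left _ (mem_union_right _ (hsp ▸ hp))
  · have hdisj : Disjoint (H.pages p) (H.pages q) := disjoint_left.2 fun z hzp hzq =>
      hH.pair_notMem_of_mem_pages hp hq hpq hxp hyq hzp hzq hsE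
    have hp_sep := mem_separatedSpines.2 ⟨hp, q, hq, hdisj⟩
    have hq_sep := mem_separatedSpines.2 ⟨hq, p, hp, hdisj.symm⟩
    refine mem_union_right _ (mem_powersetCard.2 ⟨?_, hs2⟩)
    simp only [insert_subset_iff, singleton_subset_iff, mem_biUnion, id_eq]
    exact ⟨⟨p, hp_sep, hxp⟩, q, hq_sep, hyq⟩

theorem card_pairs_add_le (hH : H.Irreducible) :
    #{s ∈ H.edges | #s = 2} + (2 * #H.spines).choose 2 ≤
      (Fintype.card V).choose 2 + #H.spines + (2 * #H.separatedSpines).choose 2 := by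
  have hle := (card_le_card hH.pairs_subset).trans
    ((card_union_le _ _).trans (Nat.add_le_add_right (card_union_le _ _) _))
  have hsdiff := card_sdiff_add_card_eq_card
    (powersetCard_mono (n := 2) (subset_univ (H.spines.biUnion id)))
  rw [card_powersetCard, hH.card_biUnion_spines (S := H.separatedSpines) (filter_subset _ _)] at hle
  rw [card_powersetCard, card_powersetCard, card_univ, hH.card_biUnion_spines le_rfl] at hsdiff
  omega

theorem card_triangles_le (hH : H.Irreducible) :
    #H.triangles ≤ ∑ p ∈ H.spines, #(H.pages p) := by
  have hcover : H.triangles ⊆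
      H.spines.biUnion fun p => (H.pages p).image fun x => insert x p := by
    intro D hD
    obtain ⟨p, hp, hpD⟩ := hH.exists_spine_subset hD
    obtain ⟨x, hx, rfl⟩ := exists_mem_pages_eq_insert hD hpD (mem_spines.1 hp).1
    exact mem_biUnion.2 ⟨p, hp, mem_image_of_mem _ hx⟩
  exact (card_le_card hcover).trans (card_biUnion_le.trans (sum_le_sum fun _ _ => card_image_le))

theorem card_edges_le_sum (hH : H.Irreducible) :
    #H.edges ≤ 1 + Fintype.card V + #{s ∈ H.edges | #s = 2} + ∑ p ∈ H.spines, #(H.pages p) := by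
  have hcover : H.edges ⊆
      ({s | #s ≤ 1} : Finset (Finset V)) ∪ {s ∈ H.edges | #s = 2} ∪ H.triangles := by
    intro s hs
    have := hH.card_le_three hs
    simp only [mem_union, mem_filter, mem_univ, mem_triangles, hs, true_and]
    omega
  have hsmall : #{s : Finset V | #s ≤ 1} = 1 + Fintype.card V := by
    rw [card_filter_card_le]
    simp [sum_range_succ]
  have hle := (card_le_card hcover).trans
    ((card_union_le _ _).trans (Nat.add_le_add_right (card_union_le _ _) _))
  have := hH.card_triangles_le
  omega

theorem card_pages_add_le_of_disjoint (hH : H.Irreducible) (hp : p ∈ H.spines)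
    (hq : q ∈ H.spines) (hpq : Disjoint (H.pages p) (H.pages q)) :
    #(H.pages p) + #(H.pages q) ≤ #(H.spines.biUnion id)ᶜ := by
  rw [← card_union_of_disjoint hpq]
  exact card_le_card (union_subset
    (subset_compl_iff_disjoint_right.2 (hH.disjoint_pages_biUnion_spines hp))
    (subset_compl_iff_disjoint_right.2 (hH.disjoint_pages_biUnion_spines hq)))

theorem sum_card_pages_add_le (hH : H.Irreducible) :
    16 * ∑ p ∈ H.spines, #(H.pages p) + #H.separatedSpines * (6 * Fintype.card V + 4) ≤
      16 * (#H.spines * #(H.spines.biUnion id)ᶜ) := calc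
  16 * ∑ p ∈ H.spines, #(H.pages p) + #H.separatedSpines * (6 * Fintype.card V + 4)
    = ∑ p ∈ H.spines, (16 * #(H.pages p) +
        if ∃ q ∈ H.spines, Disjoint (H.pages p) (H.pages q)
          then 6 * Fintype.card V + 4 else 0) := by
    rw [sum_add_distrib, mul_sum, ← sum_filter, sum_const, smul_eq_mul, separatedSpines]
  _ ≤ ∑ p ∈ H.spines, 16 * #(H.spines.biUnion id)ᶜ := by
    refine sum_le_sum fun p hp => ?_
    split_ifs with hsep
    · obtain ⟨q, hq, hpq⟩ := hsep
      have := hH.card_pages_add_le_of_disjoint hp hq hpq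
      have := hH.lt_card_pages hq
      omega
    · exact Nat.mul_le_mul_left 16 (card_le_card
        (subset_compl_iff_disjoint_right.2 (hH.disjoint_pages_biUnion_spines hp)))
  _ = _ := by rw [sum_const, smul_eq_mul, mul_left_comm]

theorem choose_two_separatedSpines_le (hH : H.Irreducible) :
    16 * (2 * #H.separatedSpines).choose 2 ≤ #H.separatedSpines * (6 * Fintype.card V + 4) := by
  obtain hempty | ⟨p, hp⟩ := H.separatedSpines.eq_empty_or_nonempty
  · simp [hempty]
  obtain ⟨hp, q, hq, hpq⟩ := mem_separatedSpines.1 hp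
  have hle : 16 * (2 * #H.separatedSpines - 1) ≤ 6 * Fintype.card V + 4 := by
    have := hH.card_pages_add_le_of_disjoint hp hq hpq
    have := hH.lt_card_pages hp
    have := hH.lt_card_pages hq
    have := card_add_card_compl (H.spines.biUnion id)
    have := hH.card_biUnion_spines le_rfl
    have : #H.separatedSpines ≤ #H.spines := card_filter_le _ _
    omega
  calc 16 * (2 * #H.separatedSpines).choose 2
      = #H.separatedSpines * (16 * (2 * #H.separatedSpines - 1)) := by
        rw [Nat.choose_two_right, mul_assoc 2, Nat.mul_div_cancel_left _ two_pos, mul_left_comm]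
    _ ≤ #H.separatedSpines * (6 * Fintype.card V + 4) := Nat.mul_le_mul_left _ hle

end Irreducible

end Irreducible

/-- The number of edges of a complex made of `m` disjoint spines, `a` pages common to all of them,
and all pairs of pages. -/
def bookSize (a m : ℕ) : ℕ :=
  1 + a + a.choose 2 + (1 + a) * (3 * m)

theorem bookSize_add_sq (a m : ℕ) :
    16 * (bookSize a m : ℝ) + ((a : ℝ) + 2 - 6 * m) ^ 2 =
      9 * ((a + 2 * m : ℕ) : ℝ) ^ 2 + 12 * ((a + 2 * m : ℕ) : ℝ) + 20 := by
  rw [bookSize]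
  push_cast [Nat.cast_choose_two]
  ring

theorem bookSize_add_choose_two (a m : ℕ) :
    bookSize a m + (2 * m).choose 2 =
      1 + (a + 2 * m) + (a + 2 * m).choose 2 + m + m * a := by
  suffices ((bookSize a m + (2 * m).choose 2 : ℕ) : ℚ) =
      (1 + (a + 2 * m) + (a + 2 * m).choose 2 + m + m * a : ℕ) by exact_mod_cast this
  rw [bookSize]
  push_cast [Nat.cast_choose_two]
  ring

theorem sixteen_mul_bookSize_le (a m : ℕ) :
    16 * bookSize a m ≤ 9 * (a + 2 * m) ^ 2 + 12 * (a + 2 * m) + 20 := by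
  have := bookSize_add_sq a m
  have hsq := sq_nonneg ((a : ℝ) + 2 - 6 * m)
  suffices ((16 * bookSize a m : ℕ) : ℝ) ≤
      (9 * (a + 2 * m) ^ 2 + 12 * (a + 2 * m) + 20 : ℕ) by exact_mod_cast this
  push_cast at this ⊢
  linarith

section UpperBound

variable {V : Type*} [Fintype V] [DecidableEq V] {H : FinComplex V}

theorem Irreducible.exists_card_edges_le_bookSize (hH : H.Irreducible) :
    ∃ a m, a + 2 * m = Fintype.card V ∧ #H.edges ≤ bookSize a m := by
  refine ⟨#(H.spines.biUnion id)ᶜ, #H.spines, ?_, ?_⟩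
  · rw [← hH.card_biUnion_spines le_rfl, add_comm, card_add_card_compl]
  have := hH.card_edges_le_sum
  have := hH.card_pairs_add_le
  have := hH.sum_card_pages_add_le
  have := hH.choose_two_separatedSpines_le
  have hsize := bookSize_add_choose_two #(H.spines.biUnion id)ᶜ #H.spines
  rw [← hH.card_biUnion_spines le_rfl, add_comm _ #(H.spines.biUnion id), card_add_card_compl,
    hH.card_biUnion_spines le_rfl] at hsize
  omega

theorem Irreducible.card_edges_le (hH : H.Irreducible) :
    16 * #H.edges ≤ 9 * Fintype.card V ^ 2 + 12 * Fintype.card V + 20 := by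
  obtain ⟨a, m, hcard, hle⟩ := hH.exists_card_edges_le_bookSize
  rw [← hcard]
  exact (Nat.mul_le_mul_left 16 hle).trans (sixteen_mul_bookSize_le a m)

theorem card_comap_edges_add_card_meeting (H : FinComplex V) (D : Finset V) :
    #(H.comap (.subtype (· ∉ D))).edges + #(H.meeting D) = #H.edges := by
  rw [card_comap_edges, meeting, ← card_filter_add_card_filter_not (s := H.edges) (Disjoint · D)]
  congr 3 with e
  simp only [disjoint_left, subset_iff, mem_map, mem_univ, true_and,
    Function.Embedding.subtype_apply, Subtype.exists, exists_prop, exists_eq_right]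

end UpperBound

theorem BowtieFree.card_edges_le {V : Type*} [Fintype V] {H : FinComplex V} (hH : H.BowtieFree) :
    16 * #H.edges ≤ 9 * Fintype.card V ^ 2 + 12 * Fintype.card V + 16 * 2 ^ 12 := by
  classical
  obtain ⟨n, hn⟩ : ∃ n, Fintype.card V = n := ⟨_, rfl⟩
  induction n using Nat.strong_induction_on generalizing V with
  | h n ih =>
  by_cases hirr : H.Irreducible
  · have := hirr.card_edges_le
    omega
  rcases Nat.lt_or_ge (Fintype.card V) 13 with hsmall | hlarge
  · have hpow : #H.edges ≤ 2 ^ 12 := calc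
      #H.edges ≤ 2 ^ Fintype.card V := by simpa using card_le_univ H.edges
      _ ≤ 2 ^ 12 := Nat.pow_le_pow_right two_pos (by omega)
    omega
  obtain ⟨D, hD, hcheap⟩ : ∃ D ∈ H.triangles, 16 * #(H.meeting D) + 45 ≤ 54 * Fintype.card V := by
    by_contra! h
    exact hirr ⟨hH, hlarge, h⟩
  have hrest : Fintype.card {x // x ∉ D} + 3 = n := by
    rw [Fintype.card_subtype_compl, Fintype.card_coe, (mem_triangles.1 hD).2]
    omega
  have hle := ih _ (by omega) (hH.comap (.subtype (· ∉ D))) rfl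
  have := card_comap_edges_add_card_meeting H D
  rw [hn, ← hrest] at hcheap ⊢
  nlinarith

theorem bowtie_edges_nonempty : bowtie.edges.Nonempty :=
  ⟨{2, 3}, mem_biUnion.2 ⟨{2, 3}, by simp, mem_powerset_self _⟩⟩

theorem ex_bowtie_le (n : ℕ) : 16 * ex n bowtie ≤ 9 * n ^ 2 + 12 * n + 16 * 2 ^ 12 := by
  obtain ⟨⟨H, hH, hcard⟩, -⟩ := ex_isGreatest n bowtie bowtie_edges_nonempty
  rw [← hcard]
  simpa using BowtieFree.card_edges_le hH

section Book

/-- The complex attaining `bookSize`: the vertices of `A` are the pages, the set `M × Bool` consists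
of the spines `{(i, false), (i, true)}`, and the edges are the sets of at most two pages, and the
sets of at most one page together with vertices of a single spine. -/
def bookComplex (A M : Type*) [Fintype A] [Fintype M] [DecidableEq M] :
    FinComplex (A ⊕ M × Bool) where
  edges := {e | #e.toLeft ≤ 2 ∧ (e.toRight.Nonempty → #e.toLeft ≤ 1) ∧
    ∀ x ∈ e.toRight, ∀ y ∈ e.toRight, x.1 = y.1}
  down_closed e he e' h := by
    rw [mem_filter_univ] at he ⊢
    obtain ⟨h2, h1, hblock⟩ := he
    have hleft := card_le_card (toLeft_subset_toLeft h)
    have hright := toRight_subset_toRight h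
    exact ⟨hleft.trans h2, fun hne => hleft.trans (h1 (hne.mono hright)),
      fun x hx y hy => hblock x (hright hx) y (hright hy)⟩

variable {A M : Type*} [Fintype A] [Fintype M] [DecidableEq M]

theorem mem_bookComplex_edges {e : Finset (A ⊕ M × Bool)} :
    e ∈ (bookComplex A M).edges ↔ #e.toLeft ≤ 2 ∧ (e.toRight.Nonempty → #e.toLeft ≤ 1) ∧
      ∀ x ∈ e.toRight, ∀ y ∈ e.toRight, x.1 = y.1 :=
  mem_filter_univ e

theorem exists_mem_iff_of_mem_triangles {T : Finset (A ⊕ M × Bool)}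
    (hT : T ∈ (bookComplex A M).triangles) :
    ∃ x i, ∀ v, v ∈ T ↔ v = .inl x ∨ ∃ β, v = .inr (i, β) := by
  obtain ⟨hTE, hT3⟩ := mem_triangles.1 hT
  obtain ⟨h2, h1, hblock⟩ := mem_bookComplex_edges.1 hTE
  have hsum := card_toLeft_add_card_toRight (u := T)
  obtain ⟨⟨i, β⟩, hi⟩ : T.toRight.Nonempty := card_pos.1 (by omega)
  have hsub : T.toRight ⊆ {i} ×ˢ univ := fun y hy =>
    mem_product.2 ⟨mem_singleton.2 (hblock y hy _ hi), mem_univ _⟩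
  have hcard : #({i} ×ˢ univ : Finset (M × Bool)) = 2 := by simp
  have hle := card_le_card hsub
  have hone := h1 ⟨_, hi⟩
  obtain ⟨x, hx⟩ := card_eq_one.1 (show #T.toLeft = 1 by omega)
  have hright := eq_of_subset_of_card_le hsub (by omega)
  refine ⟨x, i, fun v => ?_⟩
  rw [← toLeft_disjSum_toRight (u := T), hx, hright]
  rcases v with y | ⟨j, γ⟩ <;> simp [-Fintype.univ_bool, eq_comm]

theorem bowtieFree_bookComplex : (bookComplex A M).BowtieFree := by
  classical
  intro hcontains
  obtain ⟨a, b, c, d, e, hnodup, hcd, habc, hade⟩ := contains_bowtie_iff.1 hcontains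
  obtain ⟨x, i, hi⟩ := exists_mem_iff_of_mem_triangles
    (mem_triangles.2 ⟨habc, card_eq_three.2 ⟨a, b, c, by grind⟩⟩)
  obtain ⟨y, j, hj⟩ := exists_mem_iff_of_mem_triangles
    (mem_triangles.2 ⟨hade, card_eq_three.2 ⟨a, d, e, by grind⟩⟩)
  have hij : i ≠ j := by
    rintro rfl
    have hinter : ∀ β, .inr (i, β) = a := fun β => by
      have := (hi (.inr (i, β))).2 (.inr ⟨β, rfl⟩)
      have := (hj (.inr (i, β))).2 (.inr ⟨β, rfl⟩)
      grind
    simpa using (hinter true).trans (hinter false).symm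
  have ha : a = .inl x ∧ a = .inl y := by
    have hai := (hi a).1 (by simp)
    have haj := (hj a).1 (by simp)
    grind
  obtain ⟨β, rfl⟩ := ((hi c).1 (by simp)).resolve_left (by grind)
  obtain ⟨γ, rfl⟩ := ((hj d).1 (by simp)).resolve_left (by grind)
  exact hij ((mem_bookComplex_edges.1 hcd).2.2 (i, β) (by simp) (j, γ) (by simp))

theorem le_card_edges_toRight_eq_empty :
    1 + Fintype.card A + (Fintype.card A).choose 2 ≤
      #{e ∈ (bookComplex A M).edges | e.toRight = ∅} := by
  have hcard : #{s : Finset A | #s ≤ 2} = 1 + Fintype.card A + (Fintype.card A).choose 2 := by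
    rw [card_filter_card_le]
    simp [sum_range_succ]
  rw [← hcard]
  refine card_le_card_of_injOn (disjSum · ∅) (fun s hs => ?_) (fun s _ t _ hst => ?_)
  · simpa [mem_bookComplex_edges, -disjSum_empty] using hs
  · simpa [-disjSum_empty] using congrArg toLeft hst

theorem le_card_edges_toRight_ne_empty :
    (1 + Fintype.card A) * (3 * Fintype.card M) ≤
      #{e ∈ (bookComplex A M).edges | e.toRight ≠ ∅} := by
  have hcard : #(({s | #s ≤ 1} : Finset (Finset A)) ×ˢ
      ((univ : Finset M) ×ˢ (univ.erase ∅ : Finset (Finset Bool)))) =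
        (1 + Fintype.card A) * (3 * Fintype.card M) := by
    rw [card_product, card_product, card_filter_card_le, card_univ, mul_comm 3]
    simp [sum_range_succ]
  rw [← hcard]
  refine card_le_card_of_injOn (fun x => x.1.disjSum ({x.2.1} ×ˢ x.2.2)) ?_ ?_
  · rintro ⟨s, i, t⟩ hx
    simp only [coe_product, Set.mem_prod, mem_coe, mem_filter_univ, mem_erase] at hx
    obtain ⟨hs, -, ht, -⟩ := hx
    simp only [coe_filter, Set.mem_ofPred_eq, mem_bookComplex_edges, toLeft_disjSum,
      toRight_disjSum, mem_product, mem_singleton]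
    refine ⟨⟨hs.trans one_le_two, fun _ => hs, ?_⟩, ?_⟩
    · rintro x ⟨hx, -⟩ y ⟨hy, -⟩
      rw [hx, hy]
    · simpa [product_eq_empty] using ht
  · rintro ⟨s, i, t⟩ hx ⟨s', i', t'⟩ hx' heq
    simp only [coe_product, Set.mem_prod, mem_coe, mem_filter_univ, mem_erase] at hx hx'
    have hleft : s = s' := by simpa [-disjSum_empty] using congrArg toLeft heq
    have hright : {i} ×ˢ t = {i'} ×ˢ t' := by
      simpa only [toRight_disjSum] using congrArg toRight heq
    have hfst := congrArg (image Prod.fst) hright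
    have hsnd := congrArg (image Prod.snd) hright
    rw [product_image_fst (nonempty_iff_ne_empty.2 hx.2.2.1),
      product_image_fst (nonempty_iff_ne_empty.2 hx'.2.2.1), singleton_inj] at hfst
    rw [product_image_snd (singleton_nonempty i), product_image_snd (singleton_nonempty i')] at hsnd
    rw [hleft, hfst, hsnd]

theorem bookSize_le_card_edges :
    bookSize (Fintype.card A) (Fintype.card M) ≤ #(bookComplex A M).edges := by
  rw [← card_filter_add_card_filter_not (·.toRight = ∅)]
  exact Nat.add_le_add le_card_edges_toRight_eq_empty le_card_edges_toRight_ne_empty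

end Book

theorem bookSize_le_ex (a m : ℕ) : bookSize a m ≤ ex (a + 2 * m) bowtie := by
  have hle := (bookSize_le_card_edges (A := Fin a) (M := Fin m)).trans
    (card_edges_le_ex bowtie_edges_nonempty bowtieFree_bookComplex)
  simpa [mul_comm m] using hle

theorem le_ex_bowtie {n m r : ℕ} (hm : 2 * m ≤ n) (hn : n + 2 = 8 * m + r) :
    9 / 8 * (n.choose 2 : ℝ) + 21 / 16 * n + 5 / 4 - (r : ℝ) ^ 2 / 16 ≤ ex n bowtie := by
  obtain ⟨a, rfl⟩ := Nat.exists_eq_add_of_le' hm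
  have hsize := bookSize_add_sq a m
  have hle : (bookSize a m : ℝ) ≤ ex (a + 2 * m) bowtie := mod_cast bookSize_le_ex a m
  have hr : (a : ℝ) + 2 - 6 * m = r := by
    have : (a : ℝ) + 2 * m + 2 = 8 * m + r := mod_cast hn
    linarith
  rw [hr] at hsize
  rw [Nat.cast_choose_two]
  linarith

end FinComplex

theorem theorem1p2 :
    (∃ C : ℕ, ∀ n : ℕ, 5 ≤ n →
      (FinComplex.ex n FinComplex.bowtie : ℝ) ≤
        9 / 8 * (n.choose 2 : ℝ) + 21 / 16 * (n : ℝ) + (C : ℝ)) ∧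
    (∃ C : ℕ, ∀ n : ℕ, 5 ≤ n →
      9 / 8 * (n.choose 2 : ℝ) + 21 / 16 * (n : ℝ) - (C : ℝ) ≤
        (FinComplex.ex n FinComplex.bowtie : ℝ)) ∧
    (∀ n : ℕ, n % 8 = 6 →
      9 / 8 * (n.choose 2 : ℝ) + 21 / 16 * (n : ℝ) + 5 / 4 ≤
        (FinComplex.ex n FinComplex.bowtie : ℝ)) := by
  refine ⟨⟨2 ^ 12, fun n _ => ?_⟩, ⟨2, fun n hn => ?_⟩, fun n hn => ?_⟩
  · have hle : (16 * FinComplex.ex n FinComplex.bowtie : ℝ) ≤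
        9 * n ^ 2 + 12 * n + 16 * 2 ^ 12 := mod_cast FinComplex.ex_bowtie_le n
    rw [Nat.cast_choose_two]
    push_cast
    linarith
  · have hle := FinComplex.le_ex_bowtie (n := n) (m := (n + 2) / 8) (r := (n + 2) % 8)
      (by omega) (Nat.div_add_mod _ _).symm
    have hr : (((n + 2) % 8 : ℕ) : ℝ) ≤ 7 := mod_cast Nat.le_of_lt_succ (Nat.mod_lt _ (by simp))
    push_cast
    nlinarith
  · have hle := FinComplex.le_ex_bowtie (n := n) (m := (n + 2) / 8) (r := 0)
      (by omega) (by omega)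
    simpa using hle
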